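/- Let $\mathbb F$ be a field. A Hom-Lie algebra $(L,\alpha)$ over $\mathbb F$ is an $\mathbb F$-vector space $L$ with a bilinear product $[\cdot,\cdot]$ and a linear map $\alpha:L\to L$ such that $[x,x]=0$ (equivalently $[x,y]=-[y,x]$ if $\operatorname{char}\mathbb F\neq 2$), $[\alpha(x),[y,z]]+[\alpha(y),[z,x]]+[\alpha(z),[x,y]]=0$ and $\alpha([x,y])=[\alpha(x),\alpha(y)]$ for all $x,y,z\in L$. Let $[L,L]$ be the linear span of all products $[x,y]$. A central subalgebra of $L$ is a subspace $N$ with $\alpha(N)\subseteq N$ and $[x,y]=0$ for all $x\in N$, $y\in L$; then $L/N$ is a Hom-Lie algebra with the induced product and map. The second homology of $(L,\alpha)$ (with trivial coefficients) is the vector space $H_2^\alpha(L)=\ker d_2/\operatorname{Im} d_3$, where $d_2:L\wedge L\to L$ and $d_3:L\wedge L\wedge L\to L\wedge L$ are the linear maps with $d_2(x\wedge y)=-[x,y]$ and $d_3(x\wedge y\wedge z)=-[x,y]\wedge\alpha(z)+[x,z]\wedge\alpha(y)-[y,z]\wedge\alpha(x)$. The tensor product $L\star L$ is the Hom-Lie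 algebra generated by the symbols $m\star n$ ($m,n\in L$) subject to the relations that $m\star n$ is bilinear in $(m,n)$ and $$[m,m']\star\alpha(n)=\alpha(m)\star[m',n]-\alpha(m')\star[m,n],$$ $$\alpha(m)\star[n,n']=[n',m]\star\alpha(n)-[n,m]\star\alpha(n'),$$ $$[m\star n,\,m'\star n']=-[n,m]\star[m',n']$$ for all $m,m',n,n'\in L$, with endomorphism given on generators by $m\star n\mapsto\alpha(m)\star\alpha(n)$. The exterior product $L\curlywedge L$ is the quotient of $L\star L$ by the ideal spanned by the elements $m\star m$, $m\in L$; the image of $m\star n$ is written $m\curlywedge n$. The exterior centre of $L$ is $$Z^{\curlywedge}_\alpha(L)=\{x\in L \mid \alpha^k(x)\curlywedge l=0 \text{ for all } l\in L,\ k\ge 0\}.$$ **Corollary 5.3.** Let $N$ be a central subalgebra of a finite-dimensional Hom-Lie algebra $(L,\alpha)$. Then $N\subseteq Z^{\curlywedge}_\alpha(L)$ if and only if $$\dim H_2^\alpha(L/N)=\dim H_2^\alpha(L)+\dim(N\cap[L,L])$$ (dimensions as vector spaces over $\mathbb F$). -/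

import Mathlib

/-- A (multiplicative) Hom-Lie algebra structure on the `F`-vector space `L`: a bilinear product
`[x, y] = bracket x y` and a linear self-map `α` which preserves the product, such that the product
is skew-symmetric and satisfies the Hom-Jacobi identity.  Skew-symmetry is stated in the form
`[x, x] = 0`, which is equivalent to `[x, y] = -[y, x]` when the characteristic is not `2`
and is the usual meaning of skew-symmetry in characteristic `2`. -/
structure HomLieAlgebra (F L : Type*) [Field F] [AddCommGroup L] [Module F L] where
  bracket : L →ₗ[F] L →ₗ[F] L
  α : L →ₗ[F] L
  bracket_self : ∀ x, bracket x x = 0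
  hom_jacobi : ∀ x y z,
    bracket (α x) (bracket y z) + bracket (α y) (bracket z x) + bracket (α z) (bracket x y) = 0
  α_bracket : ∀ x y, α (bracket x y) = bracket (α x) (α y)

namespace HomLieAlgebra

noncomputable section

/-! ### Subalgebras, ideals, centre, commutator, quotients -/

section Basic

variable {F L : Type*} [Field F] [AddCommGroup L] [Module F L] (A : HomLieAlgebra F L)

theorem bracket_skew (x y : L) : A.bracket x y = -A.bracket y x := by
  have h := A.bracket_self (x + y)
  simp only [map_add, LinearMap.add_apply, A.bracket_self, zero_add, add_zero] at h
  exact eq_neg_of_add_eq_zero_right h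

/-- A subspace is a subalgebra if it is closed under the product and invariant under `α`. -/
structure IsSubalgebra (H : Submodule F L) : Prop where
  bracket_mem : ∀ x ∈ H, ∀ y ∈ H, A.bracket x y ∈ H
  α_mem : ∀ x ∈ H, A.α x ∈ H

/-- A subalgebra `H` is an ideal if `[x, y] ∈ H` for all `x ∈ H` and `y ∈ L`. -/
structure IsIdeal (H : Submodule F L) : Prop extends A.IsSubalgebra H where
  bracket_mem_of_left : ∀ x ∈ H, ∀ y, A.bracket x y ∈ H

/-- The centre `Z(L) = {x | [x, y] = 0 for all y}`. -/
def center : Submodule F L := LinearMap.ker A.bracket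

theorem mem_center {x : L} : x ∈ A.center ↔ ∀ y, A.bracket x y = 0 := by
  simp [center, LinearMap.ext_iff]

/-- A central subalgebra is a subalgebra contained in the centre. -/
structure IsCentralSubalgebra (N : Submodule F L) : Prop extends A.IsSubalgebra N where
  le_center : N ≤ A.center

theorem IsCentralSubalgebra.isIdeal {A : HomLieAlgebra F L} {N : Submodule F L}
    (hN : A.IsCentralSubalgebra N) : A.IsIdeal N :=
  { hN.toIsSubalgebra with
    bracket_mem_of_left := fun x hx y => by
      rw [A.mem_center.1 (hN.le_center hx) y]; exact N.zero_mem }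

/-- The commutator `[L, L]`: the subspace spanned by all products `[x, y]`. -/
def commutator : Submodule F L := Submodule.span F {z | ∃ x y, A.bracket x y = z}

/-- A bilinear product on `V` descends to the quotient by a subspace `I` that absorbs products on
both sides. -/
def quotientBilin {V : Type*} [AddCommGroup V] [Module F V] (B : V →ₗ[F] V →ₗ[F] V)
    (I : Submodule F V) (hl : ∀ x ∈ I, ∀ y, B x y ∈ I) (hr : ∀ x, ∀ y ∈ I, B x y ∈ I) :
    (V ⧸ I) →ₗ[F] (V ⧸ I) →ₗ[F] (V ⧸ I) :=
  I.liftQ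
    { toFun := fun x => I.mapQ I (B x) (fun y hy => hr x y hy)
      map_add' := fun x x' => by
        refine Submodule.linearMap_qext _ (LinearMap.ext fun y => ?_)
        simp
      map_smul' := fun c x => by
        refine Submodule.linearMap_qext _ (LinearMap.ext fun y => ?_)
        simp }
    (fun x hx => by
      refine LinearMap.mem_ker.2 (Submodule.linearMap_qext _ (LinearMap.ext fun y => ?_))
      simpa using hl x hx y)

@[simp]
theorem quotientBilin_mk {V : Type*} [AddCommGroup V] [Module F V] (B : V →ₗ[F] V →ₗ[F] V)
    (I : Submodule F V) (hl : ∀ x ∈ I, ∀ y, B x y ∈ I) (hr : ∀ x, ∀ y ∈ I, B x y ∈ I) (x y : V) :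
    quotientBilin B I hl hr (Submodule.Quotient.mk x) (Submodule.Quotient.mk y) =
      Submodule.Quotient.mk (B x y) := rfl

/-- The quotient Hom-Lie algebra `(L / N, ᾱ)` of `L` by an ideal `N`. -/
def quotient (N : Submodule F L) (hN : A.IsIdeal N) : HomLieAlgebra F (L ⧸ N) where
  bracket := quotientBilin A.bracket N hN.bracket_mem_of_left (fun x y hy => by
    rw [A.bracket_skew]; exact N.neg_mem (hN.bracket_mem_of_left y hy x))
  α := N.mapQ N A.α hN.α_mem
  bracket_self x := by
    induction x using Submodule.Quotient.induction_on with
    | H x => simp [A.bracket_self]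
  hom_jacobi x y z := by
    induction x using Submodule.Quotient.induction_on with
    | H x =>
    induction y using Submodule.Quotient.induction_on with
    | H y =>
    induction z using Submodule.Quotient.induction_on with
    | H z =>
    simp only [Submodule.mapQ_apply, quotientBilin_mk, ← Submodule.Quotient.mk_add, A.hom_jacobi,
      Submodule.Quotient.mk_zero]
  α_bracket x y := by
    induction x using Submodule.Quotient.induction_on with
    | H x =>
    induction y using Submodule.Quotient.induction_on with
    | H y =>
    simp only [Submodule.mapQ_apply, quotientBilin_mk, A.α_bracket]

end Basic

/-! ### The tensor product `L ⋆ L` and the exterior product `L ⋏ L` -/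

section Exterior

variable {F L : Type*} [Field F] [AddCommGroup L] [Module F L] (A : HomLieAlgebra F L)

/-- The free non-associative algebra on the symbols `m ⋆ n`, with `m, n ∈ L`. -/
abbrev FreeAlg (_A : HomLieAlgebra F L) : Type _ := FreeNonUnitalNonAssocAlgebra F (L × L)

/-- The symbol `m ⋆ n` in the free non-associative algebra. -/
def gen (m n : L) : A.FreeAlg := FreeNonUnitalNonAssocAlgebra.of F (m, n)

/-- The endomorphism of the free non-associative algebra given on the symbols by
`m ⋆ n ↦ α m ⋆ α n`. -/
def freeα : A.FreeAlg →ₙₐ[F] A.FreeAlg :=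
  FreeNonUnitalNonAssocAlgebra.lift F fun p => A.gen (A.α p.1) (A.α p.2)

@[simp]
theorem freeα_gen (m n : L) : A.freeα (A.gen m n) = A.gen (A.α m) (A.α n) :=
  FreeNonUnitalNonAssocAlgebra.lift_of_apply _ _ _

/-- The elements set to zero in `L ⋆ L`: those expressing the laws of a Hom-Lie algebra (`alt`
and `jac`), and the defining relations of the tensor product of `L` with itself, where `L` acts on
itself by the product `ᵐn = [m, n]`. -/
inductive TensorRel : A.FreeAlg → Prop
  | alt (a : A.FreeAlg) : TensorRel (a * a)
  | jac (a b c : A.FreeAlg) :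
      TensorRel (A.freeα a * (b * c) + A.freeα b * (c * a) + A.freeα c * (a * b))
  | smul_left (c : F) (m n : L) : TensorRel (c • A.gen m n - A.gen (c • m) n)
  | smul_right (c : F) (m n : L) : TensorRel (c • A.gen m n - A.gen m (c • n))
  | add_left (m m' n : L) : TensorRel (A.gen (m + m') n - (A.gen m n + A.gen m' n))
  | add_right (m n n' : L) : TensorRel (A.gen m (n + n') - (A.gen m n + A.gen m n'))
  | bracket_left (m m' n : L) :
      TensorRel (A.gen (A.bracket m m') (A.α n) -
        (A.gen (A.α m) (A.bracket m' n) - A.gen (A.α m') (A.bracket m n)))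
  | bracket_right (m n n' : L) :
      TensorRel (A.gen (A.α m) (A.bracket n n') -
        (A.gen (A.bracket n' m) (A.α n) - A.gen (A.bracket n m) (A.α n')))
  | mul (m n m' n' : L) :
      TensorRel (A.gen m n * A.gen m' n' - (-A.gen (A.bracket n m) (A.bracket m' n')))

/-- The two-sided ideal generated by the elements `TensorRel`, that is, the smallest subspace which
contains them and is closed under multiplication by arbitrary elements on either side. -/
def tensorIdeal : Submodule F A.FreeAlg :=
  sInf {I | (∀ a, A.TensorRel a → a ∈ I) ∧ ∀ a ∈ I, ∀ b, a * b ∈ I ∧ b * a ∈ I}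

theorem mem_tensorIdeal_of_rel {a : A.FreeAlg} (h : A.TensorRel a) : a ∈ A.tensorIdeal := by
  simp only [tensorIdeal, Submodule.mem_sInf, Set.mem_ofPred_eq]
  exact fun I hI => hI.1 a h

theorem tensorIdeal_mul_mem {a : A.FreeAlg} (h : a ∈ A.tensorIdeal) (b : A.FreeAlg) :
    a * b ∈ A.tensorIdeal ∧ b * a ∈ A.tensorIdeal := by
  simp only [tensorIdeal, Submodule.mem_sInf, Set.mem_ofPred_eq] at h ⊢
  exact ⟨fun I hI => (hI.2 a (h I hI) b).1, fun I hI => (hI.2 a (h I hI) b).2⟩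

theorem mul_mem_left (a : A.FreeAlg) (h : a ∈ A.tensorIdeal) (b : A.FreeAlg) :
    LinearMap.mul F A.FreeAlg a b ∈ A.tensorIdeal := (A.tensorIdeal_mul_mem h b).1

theorem mul_mem_right (b a : A.FreeAlg) (h : a ∈ A.tensorIdeal) :
    LinearMap.mul F A.FreeAlg b a ∈ A.tensorIdeal := (A.tensorIdeal_mul_mem h b).2

theorem tensorRel_freeα {a : A.FreeAlg} (h : A.TensorRel a) : A.TensorRel (A.freeα a) := by
  cases h with
  | alt a => rw [map_mul]; exact .alt _
  | jac a b c => simp only [map_add, map_mul]; exact .jac _ _ _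
  | smul_left c m n =>
    simp only [map_sub, map_smul, freeα_gen]; exact .smul_left _ _ _
  | smul_right c m n =>
    simp only [map_sub, map_smul, freeα_gen]; exact .smul_right _ _ _
  | add_left m m' n => simp only [map_sub, map_add, freeα_gen]; exact .add_left _ _ _
  | add_right m n n' => simp only [map_sub, map_add, freeα_gen]; exact .add_right _ _ _
  | bracket_left m m' n =>
    simp only [map_sub, freeα_gen, A.α_bracket]; exact .bracket_left _ _ _
  | bracket_right m n n' =>
    simp only [map_sub, freeα_gen, A.α_bracket]; exact .bracket_right _ _ _
  | mul m n m' n' =>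
    simp only [map_sub, map_neg, map_mul, freeα_gen, A.α_bracket]; exact .mul _ _ _ _

/-- `freeα` as a linear map. -/
def freeαLin : A.FreeAlg →ₗ[F] A.FreeAlg := (A.freeα : A.FreeAlg →ₗ[F] A.FreeAlg)

theorem freeαLin_apply (a : A.FreeAlg) : A.freeαLin a = A.freeα a := rfl

theorem tensorIdeal_le_comap : A.tensorIdeal ≤ A.tensorIdeal.comap A.freeαLin := by
  have key : A.tensorIdeal ≤ A.tensorIdeal.comap (A.freeα : A.FreeAlg →ₗ[F] A.FreeAlg) := by
    refine sInf_le ⟨fun a ha => A.mem_tensorIdeal_of_rel (A.tensorRel_freeα ha),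
      fun a ha b => ?_⟩
    have := A.tensorIdeal_mul_mem (a := A.freeα a) ha (A.freeα b)
    rw [← map_mul, ← map_mul] at this
    exact this
  exact key

/-- The underlying vector space of the (Hom-Lie) tensor product `L ⋆ L`. -/
abbrev TensorSquare : Type _ := A.FreeAlg ⧸ A.tensorIdeal

/-- The Hom-Lie algebra `(L ⋆ L, α_⋆)` generated by the symbols `m ⋆ n` subject to the relations
above, with `α_⋆ (m ⋆ n) = α m ⋆ α n`. -/
def tensorSquare : HomLieAlgebra F A.TensorSquare where
  bracket := quotientBilin (LinearMap.mul F A.FreeAlg) A.tensorIdeal A.mul_mem_left A.mul_mem_right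
  α := A.tensorIdeal.mapQ A.tensorIdeal A.freeαLin A.tensorIdeal_le_comap
  bracket_self x := by
    induction x using Submodule.Quotient.induction_on with
    | H x =>
    rw [quotientBilin_mk, Submodule.Quotient.mk_eq_zero]
    exact A.mem_tensorIdeal_of_rel (.alt x)
  hom_jacobi x y z := by
    induction x using Submodule.Quotient.induction_on with
    | H x =>
    induction y using Submodule.Quotient.induction_on with
    | H y =>
    induction z using Submodule.Quotient.induction_on with
    | H z =>
    simp only [Submodule.mapQ_apply, quotientBilin_mk, ← Submodule.Quotient.mk_add]
    rw [Submodule.Quotient.mk_eq_zero]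
    exact A.mem_tensorIdeal_of_rel (.jac x y z)
  α_bracket x y := by
    induction x using Submodule.Quotient.induction_on with
    | H x =>
    induction y using Submodule.Quotient.induction_on with
    | H y =>
    simp only [Submodule.mapQ_apply, quotientBilin_mk]
    exact congrArg Submodule.Quotient.mk (map_mul A.freeα x y)

/-- The element `m ⋆ n` of `L ⋆ L`. -/
def tmul (m n : L) : A.TensorSquare := Submodule.Quotient.mk (A.gen m n)

/-- `L □ L`, the subspace of `L ⋆ L` spanned by the elements `m ⋆ n` with `m = n`. -/
def boxSquare : Submodule F A.TensorSquare :=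
  Submodule.span F {t | ∃ m n : L, m = n ∧ A.tmul m n = t}

theorem tensorSquare_α_tmul (m n : L) :
    A.tensorSquare.α (A.tmul m n) = A.tmul (A.α m) (A.α n) := by
  change Submodule.Quotient.mk (A.freeα (A.gen m n)) = _
  rw [freeα_gen]; rfl

theorem tmul_bracket_tmul (m n m' n' : L) :
    A.tensorSquare.bracket (A.tmul m n) (A.tmul m' n') =
      -A.tmul (A.bracket n m) (A.bracket m' n') :=
  (Submodule.Quotient.eq _).2 (A.mem_tensorIdeal_of_rel (.mul m n m' n'))

theorem tmul_add_left (m m' n : L) : A.tmul (m + m') n = A.tmul m n + A.tmul m' n :=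
  (Submodule.Quotient.eq _).2 (A.mem_tensorIdeal_of_rel (.add_left m m' n))

theorem tmul_add_right (m n n' : L) : A.tmul m (n + n') = A.tmul m n + A.tmul m n' :=
  (Submodule.Quotient.eq _).2 (A.mem_tensorIdeal_of_rel (.add_right m n n'))

theorem smul_tmul_left (c : F) (m n : L) : A.tmul (c • m) n = c • A.tmul m n :=
  ((Submodule.Quotient.eq _).2 (A.mem_tensorIdeal_of_rel (.smul_left c m n))).symm

theorem smul_tmul_right (c : F) (m n : L) : A.tmul m (c • n) = c • A.tmul m n :=
  ((Submodule.Quotient.eq _).2 (A.mem_tensorIdeal_of_rel (.smul_right c m n))).symm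

theorem tmul_zero_left (n : L) : A.tmul 0 n = 0 := by
  simpa using A.smul_tmul_left 0 0 n

/-- `L ⋆ L` is spanned, as a vector space, by the elements `m ⋆ n`. -/
theorem span_tmul : Submodule.span F {t | ∃ m n, A.tmul m n = t} = ⊤ := by
  set S := Submodule.span F {t | ∃ m n, A.tmul m n = t} with hS
  have hmul : ∀ x ∈ S, ∀ y ∈ S, A.tensorSquare.bracket x y ∈ S := by
    intro x hx y hy
    induction hx, hy using Submodule.span_induction₂ with
    | mem_mem x y hx hy =>
      obtain ⟨m, n, rfl⟩ := hx
      obtain ⟨m', n', rfl⟩ := hy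
      rw [tmul_bracket_tmul]
      exact S.neg_mem (Submodule.subset_span ⟨_, _, rfl⟩)
    | zero_left y hy => simp
    | zero_right x hx => simp
    | add_left x y z _ _ _ h₁ h₂ => simpa using S.add_mem h₁ h₂
    | add_right x y z _ _ _ h₁ h₂ => simpa using S.add_mem h₁ h₂
    | smul_left r x y _ _ h => simpa using S.smul_mem r h
    | smul_right r x y _ _ h => simpa using S.smul_mem r h
  have hmagma : ∀ w : FreeMagma (L × L),
      (Submodule.Quotient.mk (MonoidAlgebra.single w (1 : F) : A.FreeAlg) : A.TensorSquare) ∈ S := by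
    intro w
    induction w using FreeMagma.recOnMul with
    | ih1 p => exact Submodule.subset_span ⟨p.1, p.2, rfl⟩
    | ih2 x y hx hy =>
      have := hmul _ hx _ hy
      rw [show A.tensorSquare.bracket
        (Submodule.Quotient.mk (MonoidAlgebra.single x (1 : F) : A.FreeAlg))
        (Submodule.Quotient.mk (MonoidAlgebra.single y (1 : F) : A.FreeAlg)) =
        Submodule.Quotient.mk ((MonoidAlgebra.single x (1 : F) : A.FreeAlg) *
          (MonoidAlgebra.single y (1 : F) : A.FreeAlg)) from rfl] at this
      rwa [MonoidAlgebra.single_mul_single, one_mul] at this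
  refine eq_top_iff.2 fun t _ => ?_
  induction t using Submodule.Quotient.induction_on with
  | H a =>
  induction a using MonoidAlgebra.induction_linear with
  | zero => simp
  | add f g hf hg => rw [Submodule.Quotient.mk_add]; exact S.add_mem (hf trivial) (hg trivial)
  | single w r =>
    have := S.smul_mem r (hmagma w)
    rw [← Submodule.Quotient.mk_smul] at this
    simpa using this

/-- `L □ L` is an ideal of `L ⋆ L` (indeed a central one). -/
theorem boxSquare_isIdeal : A.tensorSquare.IsIdeal A.boxSquare := by
  have h0 : ∀ x ∈ A.boxSquare, ∀ y, A.tensorSquare.bracket x y = 0 := by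
    intro x hx y
    have hy : y ∈ Submodule.span F {t | ∃ m n, A.tmul m n = t} := by rw [A.span_tmul]; trivial
    induction hx, hy using Submodule.span_induction₂ with
    | mem_mem x y hx hy =>
      obtain ⟨m, _, rfl, rfl⟩ := hx
      obtain ⟨m', n', rfl⟩ := hy
      rw [tmul_bracket_tmul, A.bracket_self, tmul_zero_left, neg_zero]
    | zero_left y hy => simp
    | zero_right x hx => simp
    | add_left x y z _ _ _ h₁ h₂ => simp [h₁, h₂]
    | add_right x y z _ _ _ h₁ h₂ => simp [h₁, h₂]
    | smul_left r x y _ _ h => simp [h]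
    | smul_right r x y _ _ h => simp [h]
  refine ⟨⟨fun x hx y _ => ?_, fun x hx => ?_⟩, fun x hx y => ?_⟩
  · rw [h0 x hx y]; exact Submodule.zero_mem _
  · induction hx using Submodule.span_induction with
    | mem x hx =>
      obtain ⟨m, _, rfl, rfl⟩ := hx
      rw [tensorSquare_α_tmul]
      exact Submodule.subset_span ⟨_, _, rfl, rfl⟩
    | zero => simp
    | add x y _ _ hx hy => rw [map_add]; exact Submodule.add_mem _ hx hy
    | smul r x _ hx => rw [map_smul]; exact Submodule.smul_mem _ r hx
  · rw [h0 x hx y]; exact Submodule.zero_mem _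

/-- The underlying vector space of the (Hom-Lie) exterior product `L ⋏ L`. -/
abbrev ExteriorSquare : Type _ := A.TensorSquare ⧸ A.boxSquare

/-- The Hom-Lie algebra `(L ⋏ L, α_⋏)`, the quotient of `L ⋆ L` by the ideal `L □ L`. -/
def exteriorSquare : HomLieAlgebra F A.ExteriorSquare :=
  A.tensorSquare.quotient A.boxSquare A.boxSquare_isIdeal

/-- The element `m ⋏ n` of `L ⋏ L`. -/
def emul (m n : L) : A.ExteriorSquare := Submodule.Quotient.mk (A.tmul m n)

/-- The exterior centre `Z^⋏_α(L) = {x | α^k(x) ⋏ l = 0 for all l ∈ L and k ≥ 0}`. -/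
def exteriorCenter : Submodule F L where
  carrier := {x | ∀ (l : L) (k : ℕ), A.emul ((A.α ^ k) x) l = 0}
  add_mem' {x y} hx hy l k := by
    have h : A.emul ((A.α ^ k) (x + y)) l = A.emul ((A.α ^ k) x) l + A.emul ((A.α ^ k) y) l := by
      simp only [emul, map_add, tmul_add_left, Submodule.Quotient.mk_add]
    rw [h, hx l k, hy l k, add_zero]
  zero_mem' l k := by simp [emul, tmul_zero_left]
  smul_mem' c x hx l k := by
    have h : A.emul ((A.α ^ k) (c • x)) l = c • A.emul ((A.α ^ k) x) l := by
      simp only [emul, map_smul, smul_tmul_left, Submodule.Quotient.mk_smul]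
    rw [h, hx l k, smul_zero]

end Exterior

/-! ### The second homology with trivial coefficients -/

section Homology

variable {F L : Type*} [Field F] [AddCommGroup L] [Module F L] (A : HomLieAlgebra F L)

/-- The homology `ker f / im g` of a sequence `U → V → W` of linear maps `g`, `f`
with `f ∘ g = 0`. -/
def KerModRange {U V W : Type*} [AddCommGroup U] [Module F U] [AddCommGroup V] [Module F V]
    [AddCommGroup W] [Module F W] (f : V →ₗ[F] W) (g : U →ₗ[F] V) : Type _ :=
  LinearMap.ker f ⧸ (LinearMap.range g).submoduleOf (LinearMap.ker f)

instance {U V W : Type*} [AddCommGroup U] [Module F U] [AddCommGroup V] [Module F V]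
    [AddCommGroup W] [Module F W] (f : V →ₗ[F] W) (g : U →ₗ[F] V) :
    AddCommGroup (KerModRange f g) :=
  inferInstanceAs (AddCommGroup (LinearMap.ker f ⧸ (LinearMap.range g).submoduleOf _))

instance {U V W : Type*} [AddCommGroup U] [Module F U] [AddCommGroup V] [Module F V]
    [AddCommGroup W] [Module F W] (f : V →ₗ[F] W) (g : U →ₗ[F] V) :
    Module F (KerModRange f g) :=
  inferInstanceAs (Module F (LinearMap.ker f ⧸ (LinearMap.range g).submoduleOf _))

/-- The product as an alternating map in two variables. -/
def bracketAlt : L [⋀^Fin 2]→ₗ[F] L where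
  toFun v := A.bracket (v 0) (v 1)
  map_update_add' v i x y := by
    fin_cases i <;> simp
  map_update_smul' v i c x := by
    fin_cases i <;> simp
  map_eq_zero_of_eq' v i j hv hij := by
    fin_cases i <;> fin_cases j <;> simp_all [A.bracket_self]

/-- `x ∧ y` in the second exterior power, as a bilinear map. -/
def wedge : L →ₗ[F] L →ₗ[F] ⋀[F]^2 L :=
  LinearMap.mk₂ F (fun x y => exteriorPower.ιMulti F 2 ![x, y])
    (fun x x' y => by
      have h (z : L) : (![z, y] : Fin 2 → L) = Function.update ![0, y] 0 z := by
        ext i; fin_cases i <;> simp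
      rw [h, h x, h x', AlternatingMap.map_update_add])
    (fun c x y => by
      have h (z : L) : (![z, y] : Fin 2 → L) = Function.update ![0, y] 0 z := by
        ext i; fin_cases i <;> simp
      rw [h, h x, AlternatingMap.map_update_smul])
    (fun x y y' => by
      have h (z : L) : (![x, z] : Fin 2 → L) = Function.update ![x, 0] 1 z := by
        ext i; fin_cases i <;> simp
      rw [h, h y, h y', AlternatingMap.map_update_add])
    (fun c x y => by
      have h (z : L) : (![x, z] : Fin 2 → L) = Function.update ![x, 0] 1 z := by
        ext i; fin_cases i <;> simp
      rw [h, h y, AlternatingMap.map_update_smul])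

theorem wedge_apply (x y : L) :
    wedge (F := F) x y = exteriorPower.ιMulti F 2 ![x, y] := rfl

theorem wedge_self (x : L) : wedge (F := F) x x = 0 := by
  rw [wedge_apply]
  exact (exteriorPower.ιMulti F 2).map_eq_zero_of_eq ![x, x] (i := 0) (j := 1) rfl (by decide)

theorem wedge_skew (x y : L) : wedge (F := F) x y = -wedge (F := F) y x := by
  have h := wedge_self (F := F) (x + y)
  simp only [map_add, LinearMap.add_apply, wedge_self, zero_add, add_zero] at h
  exact eq_neg_of_add_eq_zero_right h

/-- The alternating map
`(x, y, z) ↦ -[x, y] ∧ α z + [x, z] ∧ α y - [y, z] ∧ α x`. -/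
def boundaryAlt : L [⋀^Fin 3]→ₗ[F] ⋀[F]^2 L where
  toFun v := -wedge (A.bracket (v 0) (v 1)) (A.α (v 2))
    + wedge (A.bracket (v 0) (v 2)) (A.α (v 1)) - wedge (A.bracket (v 1) (v 2)) (A.α (v 0))
  map_update_add' v i x y := by
    have e10 : (1 : Fin 3) ≠ 0 := by omega
    have e20 : (2 : Fin 3) ≠ 0 := by omega
    have e21 : (2 : Fin 3) ≠ 1 := by omega
    obtain rfl | rfl | rfl : i = 0 ∨ i = 1 ∨ i = 2 := by omega
    all_goals
      simp only [Function.update_self, Function.update_of_ne e10, Function.update_of_ne e20,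
        Function.update_of_ne e21, Function.update_of_ne e10.symm, Function.update_of_ne e20.symm,
        Function.update_of_ne e21.symm, map_add, LinearMap.add_apply]
      abel
  map_update_smul' v i c x := by
    have e10 : (1 : Fin 3) ≠ 0 := by omega
    have e20 : (2 : Fin 3) ≠ 0 := by omega
    have e21 : (2 : Fin 3) ≠ 1 := by omega
    obtain rfl | rfl | rfl : i = 0 ∨ i = 1 ∨ i = 2 := by omega
    all_goals
      simp only [Function.update_self, Function.update_of_ne e10, Function.update_of_ne e20,
        Function.update_of_ne e21, Function.update_of_ne e10.symm, Function.update_of_ne e20.symm,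
        Function.update_of_ne e21.symm, map_smul, LinearMap.smul_apply,
        smul_sub, smul_add, smul_neg]
  map_eq_zero_of_eq' v i j hv hij := by
    have h : v 0 = v 1 ∨ v 0 = v 2 ∨ v 1 = v 2 := by
      fin_cases i <;> fin_cases j <;>
        first
        | exact absurd rfl hij
        | exact .inl hv
        | exact .inl hv.symm
        | exact .inr (.inl hv)
        | exact .inr (.inl hv.symm)
        | exact .inr (.inr hv)
        | exact .inr (.inr hv.symm)
    rcases h with h | h | h
    · rw [h, A.bracket_self]; simp
    · rw [h, A.bracket_self, A.bracket_skew (v 1) (v 2)]; simp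
    · rw [h, A.bracket_self]; simp

/-- The boundary map `d₂ : L ∧ L → L`, `d₂ (x ∧ y) = -[x, y]`, of the chain complex
`C_n = F ⊗ L^{∧ n} = L^{∧ n}` with trivial coefficients `(F, id)`. -/
def d₂ : ⋀[F]^2 L →ₗ[F] L := exteriorPower.alternatingMapLinearEquiv (-A.bracketAlt)

/-- The boundary map `d₃ : L ∧ L ∧ L → L ∧ L`,
`d₃ (x ∧ y ∧ z) = -[x, y] ∧ α z + [x, z] ∧ α y - [y, z] ∧ α x`, of the same complex. -/
def d₃ : ⋀[F]^3 L →ₗ[F] ⋀[F]^2 L := exteriorPower.alternatingMapLinearEquiv A.boundaryAlt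

theorem d₂_wedge (x y : L) : A.d₂ (wedge x y) = -A.bracket x y :=
  exteriorPower.alternatingMapLinearEquiv_apply_ιMulti (-A.bracketAlt) ![x, y]

theorem d₃_ιMulti (v : Fin 3 → L) : A.d₃ (exteriorPower.ιMulti F 3 v) =
    -wedge (A.bracket (v 0) (v 1)) (A.α (v 2))
      + wedge (A.bracket (v 0) (v 2)) (A.α (v 1)) - wedge (A.bracket (v 1) (v 2)) (A.α (v 0)) :=
  exteriorPower.alternatingMapLinearEquiv_apply_ιMulti A.boundaryAlt v

theorem d₂_comp_d₃ : A.d₂ ∘ₗ A.d₃ = 0 := by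
  refine exteriorPower.linearMap_ext (AlternatingMap.ext fun v => ?_)
  have h := A.hom_jacobi (v 0) (v 1) (v 2)
  rw [A.bracket_skew (v 2) (v 0), map_neg] at h
  simp only [LinearMap.compAlternatingMap_apply, LinearMap.comp_apply, d₃_ιMulti, map_add, map_sub,
    map_neg, d₂_wedge, LinearMap.zero_apply]
  rw [A.bracket_skew (A.bracket (v 0) (v 1)) (A.α (v 2)),
    A.bracket_skew (A.bracket (v 0) (v 2)) (A.α (v 1)),
    A.bracket_skew (A.bracket (v 1) (v 2)) (A.α (v 0)), ← neg_eq_zero, ← h]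
  abel

/-- The second homology `H₂^α(L) = ker d₂ / im d₃` of `L` with coefficients in the trivial
Hom-`L`-module `(F, id)`. -/
abbrev H₂ : Type _ := KerModRange A.d₂ A.d₃

end Homology

end

end HomLieAlgebra

/-! Write `B(L) = (L ∧ L) / im d₃`. The exterior product `L ⋏ L` is `B(L)` in disguise. With
skew-symmetry, both bracket relations of the tensor product become the relation `d₃(x ∧ y ∧ z) = 0`.
Conversely `B(L)` is itself a Hom-Lie algebra under `[a, b] = κ(a) ∧ κ(b)`, where `κ(x ∧ y) = [x,
y]`, and it satisfies every defining relation of `L ⋏ L`. Hence `m ⋏ n = 0` exactly when `m ∧ n`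
lies in `im d₃` (`emul_eq_zero_iff`), and for an `α`-stable `N`, lying in the exterior centre means
that `N ∧ L` vanishes in `B(L)`.

The projection `L → L/N` induces a surjection `B(L) → B(L/N)`. It is injective exactly when `N ∧ L`
vanishes in `B(L)` (`boundaryQuotientMap_injective_iff`), which in finite dimension is the equality
`dim B(L) = dim B(L/N)`.

Finally `dim B(L) = dim H₂(L) + dim [L, L]`, because `d₂` has image `[L, L]`. The same holds for
`L/N`, whose commutator is the image of `[L, L]` and so has dimension `dim [L, L] - dim (N ∩ [L,
L])`. Comparing the two formulas turns equality of the dimensions of `B` into the stated equality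
for `H₂`. -/

namespace HomLieAlgebra

noncomputable section

/-! ### Second exterior powers: universal property and functoriality. -/

section ExteriorPowerTwo

variable {F V W : Type*} [Field F] [AddCommGroup V] [Module F V] [AddCommGroup W] [Module F W]

/-- The linear map out of the second exterior power induced by an alternating bilinear map. -/
def wedgeLift (B : V →ₗ[F] V →ₗ[F] W) (hB : ∀ x, B x x = 0) : ⋀[F]^2 V →ₗ[F] W :=
  exteriorPower.alternatingMapLinearEquiv
    { toFun := fun v => B (v 0) (v 1)
      map_update_add' := fun v i x y => by
        fin_cases i <;> simp
      map_update_smul' := fun v i c x => by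
        fin_cases i <;> simp
      map_eq_zero_of_eq' := fun v i j hv hij => by
        fin_cases i <;> fin_cases j <;> simp_all }

@[simp]
theorem wedgeLift_wedge (B : V →ₗ[F] V →ₗ[F] W) (hB : ∀ x, B x x = 0) (x y : V) :
    wedgeLift B hB (wedge x y) = B x y :=
  exteriorPower.alternatingMapLinearEquiv_apply_ιMulti _ ![x, y]

theorem linearMap_ext_wedge {f g : ⋀[F]^2 V →ₗ[F] W}
    (h : ∀ x y, f (wedge x y) = g (wedge x y)) : f = g := by
  refine exteriorPower.linearMap_ext (AlternatingMap.ext fun v => ?_)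
  have hv : v = ![v 0, v 1] := by
    ext i; fin_cases i <;> rfl
  rw [hv]
  exact h _ _

/-- The linear map of second exterior powers induced by a linear map. -/
def wedgeMap (f : V →ₗ[F] W) : ⋀[F]^2 V →ₗ[F] ⋀[F]^2 W :=
  wedgeLift (wedge.compl₁₂ f f) fun _ => wedge_self _

@[simp]
theorem wedgeMap_wedge (f : V →ₗ[F] W) (x y : V) :
    wedgeMap f (wedge (F := F) x y) = wedge (f x) (f y) :=
  wedgeLift_wedge (wedge.compl₁₂ f f) _ x y

/-- Over a field `f` has a linear section, and the exterior square of that section is a section of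
`wedgeMap f`. -/
theorem wedgeMap_surjective {f : V →ₗ[F] W} (hf : Function.Surjective f) :
    Function.Surjective (wedgeMap f) := by
  obtain ⟨g, hg⟩ := f.exists_rightInverse_of_surjective (LinearMap.range_eq_top.2 hf)
  have h : wedgeMap f ∘ₗ wedgeMap g = LinearMap.id := by
    refine linearMap_ext_wedge fun x y => ?_
    have h' (z : W) : f (g z) = z := LinearMap.congr_fun hg z
    simp [h']
  exact fun t => ⟨wedgeMap g t, LinearMap.congr_fun h t⟩

end ExteriorPowerTwo

/-! ### The Hom-Lie algebra `(L ∧ L) / im d₃`. -/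

section BoundaryQuotient

variable {F L : Type*} [Field F] [AddCommGroup L] [Module F L] (A : HomLieAlgebra F L)

/-- The space `(L ∧ L) / im d₃`. -/
abbrev BoundaryQuotient : Type _ := ⋀[F]^2 L ⧸ LinearMap.range A.d₃

/-- The class of `x ∧ y` modulo `im d₃`. -/
def wedgeClass : L →ₗ[F] L →ₗ[F] A.BoundaryQuotient :=
  wedge.compr₂ (LinearMap.range A.d₃).mkQ

theorem wedgeClass_apply (x y : L) :
    A.wedgeClass x y = Submodule.Quotient.mk (wedge x y) := rfl

theorem wedgeClass_self (x : L) : A.wedgeClass x x = 0 := by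
  rw [wedgeClass_apply, wedge_self, Submodule.Quotient.mk_zero]

theorem wedgeClass_skew (x y : L) : A.wedgeClass x y = -A.wedgeClass y x := by
  rw [wedgeClass_apply, wedge_skew, Submodule.Quotient.mk_neg, wedgeClass_apply]

/-- This is `d₃(x ∧ y ∧ z) = 0` in the quotient, solved for its first term so as to match the
criterion in `range_d₃_le_ker`. -/
theorem wedgeClass_boundary (x y z : L) :
    A.wedgeClass (A.bracket x y) (A.α z) =
      A.wedgeClass (A.bracket x z) (A.α y) - A.wedgeClass (A.bracket y z) (A.α x) := by
  have h : (Submodule.Quotient.mk (A.d₃ (exteriorPower.ιMulti F 3 ![x, y, z])) :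
      A.BoundaryQuotient) = 0 := (Submodule.Quotient.mk_eq_zero _).2 ⟨_, rfl⟩
  rw [d₃_ιMulti] at h
  change -A.wedgeClass (A.bracket x y) (A.α z) + A.wedgeClass (A.bracket x z) (A.α y) -
    A.wedgeClass (A.bracket y z) (A.α x) = 0 at h
  rw [← sub_eq_zero, ← neg_eq_zero, ← h]
  abel

/-- A linear map on `L ∧ L` vanishes on `im d₃` as soon as it does so on the generators. -/
theorem range_d₃_le_ker {W : Type*} [AddCommGroup W] [Module F W] (f : ⋀[F]^2 L →ₗ[F] W)
    (h : ∀ x y z, f (wedge (A.bracket x y) (A.α z)) =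
      f (wedge (A.bracket x z) (A.α y)) - f (wedge (A.bracket y z) (A.α x))) :
    LinearMap.range A.d₃ ≤ LinearMap.ker f := by
  rw [LinearMap.range_le_ker_iff]
  refine exteriorPower.linearMap_ext (AlternatingMap.ext fun v => ?_)
  simp only [LinearMap.compAlternatingMap_apply, LinearMap.comp_apply, d₃_ιMulti, map_add, map_sub,
    map_neg, LinearMap.zero_apply, h (v 0) (v 1) (v 2)]
  abel

theorem boundaryQuotient_ext {W : Type*} [AddCommGroup W] [Module F W]
    {f g : A.BoundaryQuotient →ₗ[F] W}
    (h : ∀ x y, f (A.wedgeClass x y) = g (A.wedgeClass x y)) : f = g :=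
  Submodule.linearMap_qext _ (linearMap_ext_wedge h)

/-- The commutator map `(L ∧ L) / im d₃ → L`, `x ∧ y ↦ [x, y]`. -/
def commutatorMap : A.BoundaryQuotient →ₗ[F] L :=
  (LinearMap.range A.d₃).liftQ (-A.d₂) (by
    rw [LinearMap.range_le_ker_iff, LinearMap.neg_comp, d₂_comp_d₃, neg_zero])

@[simp]
theorem commutatorMap_wedgeClass (x y : L) :
    A.commutatorMap (A.wedgeClass x y) = A.bracket x y := by
  change -A.d₂ (wedge x y) = _
  rw [d₂_wedge, neg_neg]

/-- The endomorphism of `(L ∧ L) / im d₃` induced by `α`. -/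
def boundaryQuotientα : A.BoundaryQuotient →ₗ[F] A.BoundaryQuotient :=
  (LinearMap.range A.d₃).liftQ ((LinearMap.range A.d₃).mkQ ∘ₗ wedgeMap A.α)
    (A.range_d₃_le_ker _ fun x y z => by
      simpa [α_bracket, wedgeClass_apply] using A.wedgeClass_boundary (A.α x) (A.α y) (A.α z))

@[simp]
theorem boundaryQuotientα_wedgeClass (x y : L) :
    A.boundaryQuotientα (A.wedgeClass x y) = A.wedgeClass (A.α x) (A.α y) := by
  change (LinearMap.range A.d₃).mkQ (wedgeMap A.α (wedge x y)) = _
  rw [wedgeMap_wedge]; rfl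

theorem commutatorMap_boundaryQuotientα (a : A.BoundaryQuotient) :
    A.commutatorMap (A.boundaryQuotientα a) = A.α (A.commutatorMap a) := by
  refine LinearMap.congr_fun
    (A.boundaryQuotient_ext (f := A.commutatorMap ∘ₗ A.boundaryQuotientα)
      (g := A.α ∘ₗ A.commutatorMap) fun x y => ?_) a
  simp [α_bracket]

/-- The Hom-Lie algebra structure on `(L ∧ L) / im d₃`, with product
`[a, b] = [a]' ∧ [b]'`, where `[·]'` is the commutator map. -/
def boundaryQuotient : HomLieAlgebra F A.BoundaryQuotient where
  bracket := A.wedgeClass.compl₁₂ A.commutatorMap A.commutatorMap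
  α := A.boundaryQuotientα
  bracket_self _ := A.wedgeClass_self _
  hom_jacobi a b c := by
    simp only [LinearMap.compl₁₂_apply, commutatorMap_wedgeClass, commutatorMap_boundaryQuotientα]
    -- The identity involves `a`, `b`, `c` only through their commutator images, and for arbitrary
    -- `x`, `y`, `z` in their place it is the boundary relation.
    generalize A.commutatorMap a = x
    generalize A.commutatorMap b = y
    generalize A.commutatorMap c = z
    have h := A.wedgeClass_boundary x y z
    rw [A.wedgeClass_skew (A.α x), A.wedgeClass_skew (A.α y), A.wedgeClass_skew (A.α z), h,
      A.bracket_skew z x, map_neg, LinearMap.neg_apply]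
    abel
  α_bracket a b := by
    simp only [LinearMap.compl₁₂_apply, commutatorMap_boundaryQuotientα,
      boundaryQuotientα_wedgeClass]

theorem boundaryQuotient_bracket (a b : A.BoundaryQuotient) :
    A.boundaryQuotient.bracket a b = A.wedgeClass (A.commutatorMap a) (A.commutatorMap b) := rfl

theorem boundaryQuotient_α (a : A.BoundaryQuotient) :
    A.boundaryQuotient.α a = A.boundaryQuotientα a := rfl

end BoundaryQuotient

/-! ### Hom-Lie algebras as targets of maps from a free non-associative algebra. -/

section Nonassociative

variable {F L : Type*} [Field F] [AddCommGroup L] [Module F L]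

/-- The underlying space of a Hom-Lie algebra, regarded as a non-associative algebra whose
multiplication is the product of the Hom-Lie algebra. -/
def Carrier (_A : HomLieAlgebra F L) : Type _ := L

variable (A : HomLieAlgebra F L)

instance : AddCommGroup A.Carrier := inferInstanceAs (AddCommGroup L)

instance : Module F A.Carrier := inferInstanceAs (Module F L)

/-- Turns the bracket into a multiplication, so that the universal property of the free
non-associative algebra applies to Hom-Lie algebras. -/
instance : NonUnitalNonAssocRing A.Carrier :=
  { (inferInstance : AddCommGroup A.Carrier) with
    mul := fun x y => A.bracket x y
    left_distrib := fun x y z => map_add (A.bracket x) y z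
    right_distrib := fun x y z => LinearMap.map_add₂ A.bracket x y z
    zero_mul := fun x => LinearMap.map_zero₂ A.bracket x
    mul_zero := fun x => map_zero (A.bracket x) }

instance : IsScalarTower F A.Carrier A.Carrier :=
  ⟨fun c x y => LinearMap.map_smul₂ A.bracket c x y⟩

instance : SMulCommClass F A.Carrier A.Carrier :=
  ⟨fun c x y => ((A.bracket x).map_smul c y).symm⟩

end Nonassociative

/-! ### Comparison of `L ⋏ L` with `(L ∧ L) / im d₃`. -/

section Comparison

variable {F L : Type*} [Field F] [AddCommGroup L] [Module F L] (A : HomLieAlgebra F L)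

/-- The homomorphism from the free non-associative algebra to `(L ∧ L) / im d₃` given on the
symbols by `m ⋆ n ↦ m ∧ n`. -/
def freeToBoundaryQuotient : A.FreeAlg →ₙₐ[F] A.boundaryQuotient.Carrier :=
  FreeNonUnitalNonAssocAlgebra.lift F fun p => A.wedgeClass p.1 p.2

theorem freeToBoundaryQuotient_gen (m n : L) :
    A.freeToBoundaryQuotient (A.gen m n) = A.wedgeClass m n :=
  FreeNonUnitalNonAssocAlgebra.lift_of_apply _ _ _

theorem freeToBoundaryQuotient_mul (a b : A.FreeAlg) :
    A.freeToBoundaryQuotient (a * b) =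
      A.boundaryQuotient.bracket (A.freeToBoundaryQuotient a) (A.freeToBoundaryQuotient b) :=
  map_mul A.freeToBoundaryQuotient a b

/-- `freeToBoundaryQuotient` as a linear map. -/
def freeToBoundaryQuotientLin : A.FreeAlg →ₗ[F] A.BoundaryQuotient :=
  (A.freeToBoundaryQuotient : A.FreeAlg →ₗ[F] A.boundaryQuotient.Carrier)

@[simp]
theorem freeToBoundaryQuotientLin_gen (m n : L) :
    A.freeToBoundaryQuotientLin (A.gen m n) = A.wedgeClass m n :=
  A.freeToBoundaryQuotient_gen m n

@[simp]
theorem freeToBoundaryQuotientLin_mul (a b : A.FreeAlg) :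
    A.freeToBoundaryQuotientLin (a * b) =
      A.boundaryQuotient.bracket (A.freeToBoundaryQuotientLin a)
        (A.freeToBoundaryQuotientLin b) :=
  A.freeToBoundaryQuotient_mul a b

/-- Both sides are linear and multiplicative in `a` and agree on the symbols, hence on all words of
the free magma, which form a basis. It is needed for the Hom-Jacobi relations, in which `freeα` is
applied to arbitrary elements. -/
theorem freeToBoundaryQuotientLin_freeα (a : A.FreeAlg) :
    A.freeToBoundaryQuotientLin (A.freeα a) =
      A.boundaryQuotient.α (A.freeToBoundaryQuotientLin a) := by
  have hmagma : ∀ w : FreeMagma (L × L),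
      A.freeToBoundaryQuotientLin (A.freeα (MonoidAlgebra.single w (1 : F) : A.FreeAlg)) =
        A.boundaryQuotient.α
          (A.freeToBoundaryQuotientLin (MonoidAlgebra.single w (1 : F) : A.FreeAlg)) := by
    intro w
    induction w using FreeMagma.recOnMul with
    | ih1 p =>
      change A.freeToBoundaryQuotientLin (A.freeα (A.gen p.1 p.2)) =
        A.boundaryQuotient.α (A.freeToBoundaryQuotientLin (A.gen p.1 p.2))
      rw [freeα_gen, freeToBoundaryQuotientLin_gen, freeToBoundaryQuotientLin_gen,
        boundaryQuotient_α, boundaryQuotientα_wedgeClass]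
    | ih2 x y hx hy =>
      have h : (MonoidAlgebra.single (x * y) (1 : F) : A.FreeAlg) =
          (MonoidAlgebra.single x (1 : F) : A.FreeAlg) *
            (MonoidAlgebra.single y (1 : F) : A.FreeAlg) := by
        rw [MonoidAlgebra.single_mul_single, one_mul]
      rw [h, map_mul, freeToBoundaryQuotientLin_mul, hx, hy, freeToBoundaryQuotientLin_mul,
        α_bracket]
  induction a using MonoidAlgebra.induction_linear with
  | zero => simp
  | add f g hf hg => simp only [map_add, hf, hg]
  | single w r =>
    have h : (MonoidAlgebra.single w r : A.FreeAlg) =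
        r • (MonoidAlgebra.single w (1 : F) : A.FreeAlg) := by simp
    rw [h, map_smul, map_smul, map_smul, map_smul, hmagma]

/-- The Hom-Lie laws hold because the target is a Hom-Lie algebra. The two bracket relations are the
boundary relation up to skew-symmetry, and the product relation is the definition of the bracket on
the target. -/
theorem freeToBoundaryQuotientLin_eq_zero_of_rel {a : A.FreeAlg} (h : A.TensorRel a) :
    A.freeToBoundaryQuotientLin a = 0 := by
  cases h with
  | alt a => rw [freeToBoundaryQuotientLin_mul, bracket_self]
  | jac a b c =>
    simp only [map_add, freeToBoundaryQuotientLin_mul, freeToBoundaryQuotientLin_freeα, hom_jacobi]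
  | smul_left c m n => simp
  | smul_right c m n => simp
  | add_left m m' n => simp
  | add_right m n n' => simp
  | bracket_left m m' n =>
    simp only [map_sub, freeToBoundaryQuotientLin_gen]
    rw [A.wedgeClass_boundary, A.wedgeClass_skew (A.α m), A.wedgeClass_skew (A.α m')]
    abel
  | bracket_right m n n' =>
    simp only [map_sub, freeToBoundaryQuotientLin_gen]
    rw [A.wedgeClass_skew (A.α m), A.wedgeClass_boundary]
    abel
  | mul m n m' n' =>
    simp only [map_sub, map_neg, freeToBoundaryQuotientLin_mul, freeToBoundaryQuotientLin_gen,
      boundaryQuotient_bracket, commutatorMap_wedgeClass]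
    rw [A.bracket_skew n m]
    simp

theorem tensorIdeal_le_ker : A.tensorIdeal ≤ LinearMap.ker A.freeToBoundaryQuotientLin := by
  -- The ideal is the least absorbing subspace containing the relations. The kernel is absorbing
  -- because the map is multiplicative.
  refine sInf_le ⟨fun a ha => A.freeToBoundaryQuotientLin_eq_zero_of_rel ha, fun a ha b => ?_⟩
  rw [LinearMap.mem_ker] at ha
  simp [ha]

/-- The linear map `L ⋆ L → (L ∧ L) / im d₃`, `m ⋆ n ↦ m ∧ n`. -/
def tensorToBoundaryQuotient : A.TensorSquare →ₗ[F] A.BoundaryQuotient :=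
  A.tensorIdeal.liftQ A.freeToBoundaryQuotientLin A.tensorIdeal_le_ker

theorem tensorToBoundaryQuotient_tmul (m n : L) :
    A.tensorToBoundaryQuotient (A.tmul m n) = A.wedgeClass m n :=
  A.freeToBoundaryQuotientLin_gen m n

/-- The linear map `L ⋏ L → (L ∧ L) / im d₃`, `m ⋏ n ↦ m ∧ n`. -/
def exteriorToBoundaryQuotient : A.ExteriorSquare →ₗ[F] A.BoundaryQuotient :=
  A.boxSquare.liftQ A.tensorToBoundaryQuotient (by
    refine Submodule.span_le.2 ?_
    rintro _ ⟨m, _, rfl, rfl⟩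
    exact (A.tensorToBoundaryQuotient_tmul m m).trans (A.wedgeClass_self m))

theorem exteriorToBoundaryQuotient_emul (m n : L) :
    A.exteriorToBoundaryQuotient (A.emul m n) = A.wedgeClass m n :=
  A.tensorToBoundaryQuotient_tmul m n

/-- `m ⋏ n` as a bilinear map. -/
def emulBilin : L →ₗ[F] L →ₗ[F] A.ExteriorSquare :=
  LinearMap.mk₂ F A.emul
    (fun m m' n => by simp only [emul, tmul_add_left, Submodule.Quotient.mk_add])
    (fun c m n => by simp only [emul, smul_tmul_left, Submodule.Quotient.mk_smul])
    (fun m n n' => by simp only [emul, tmul_add_right, Submodule.Quotient.mk_add])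
    (fun c m n => by simp only [emul, smul_tmul_right, Submodule.Quotient.mk_smul])

theorem emul_self (m : L) : A.emulBilin m m = 0 :=
  (Submodule.Quotient.mk_eq_zero _).2 (Submodule.subset_span ⟨m, m, rfl, rfl⟩)

theorem emul_skew (m n : L) : A.emulBilin m n = -A.emulBilin n m := by
  have h := A.emul_self (m + n)
  simp only [map_add, LinearMap.add_apply, emul_self, zero_add, add_zero] at h
  exact eq_neg_of_add_eq_zero_right h

theorem tmul_bracket_left (m m' n : L) :
    A.tmul (A.bracket m m') (A.α n) =
      A.tmul (A.α m) (A.bracket m' n) - A.tmul (A.α m') (A.bracket m n) :=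
  (Submodule.Quotient.eq _).2 (A.mem_tensorIdeal_of_rel (.bracket_left m m' n))

theorem emul_boundary (x y z : L) :
    A.emulBilin (A.bracket x y) (A.α z) =
      A.emulBilin (A.bracket x z) (A.α y) - A.emulBilin (A.bracket y z) (A.α x) := by
  have h : A.emulBilin (A.bracket x y) (A.α z) =
      A.emulBilin (A.α x) (A.bracket y z) - A.emulBilin (A.α y) (A.bracket x z) :=
    congrArg Submodule.Quotient.mk (A.tmul_bracket_left x y z)
  rw [h, A.emul_skew (A.α x), A.emul_skew (A.α y)]
  abel

/-- The linear map `(L ∧ L) / im d₃ → L ⋏ L`, `m ∧ n ↦ m ⋏ n`. -/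
def boundaryQuotientToExterior : A.BoundaryQuotient →ₗ[F] A.ExteriorSquare :=
  (LinearMap.range A.d₃).liftQ (wedgeLift A.emulBilin A.emul_self)
    (A.range_d₃_le_ker _ fun x y z => by
      simpa only [wedgeLift_wedge] using A.emul_boundary x y z)

theorem boundaryQuotientToExterior_wedgeClass (m n : L) :
    A.boundaryQuotientToExterior (A.wedgeClass m n) = A.emul m n :=
  wedgeLift_wedge A.emulBilin A.emul_self m n

/-- The linear maps in the two directions exchange `m ⋏ n` and `m ∧ n`, so each vanishes when the
other does. -/
theorem emul_eq_zero_iff (m n : L) : A.emul m n = 0 ↔ A.wedgeClass m n = 0 :=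
  ⟨fun h => by rw [← exteriorToBoundaryQuotient_emul, h, map_zero],
    fun h => by rw [← boundaryQuotientToExterior_wedgeClass, h, map_zero]⟩

/-- The case `k = 0` gives one direction; in the other, stability of `N` under `α` absorbs all the
powers `α ^ k`. -/
theorem le_exteriorCenter_iff {N : Submodule F L} (hN : ∀ x ∈ N, A.α x ∈ N) :
    N ≤ A.exteriorCenter ↔ ∀ x ∈ N, ∀ l, A.wedgeClass x l = 0 := by
  have hpow : ∀ k : ℕ, ∀ x ∈ N, (A.α ^ k) x ∈ N := by
    intro k
    induction k with
    | zero => exact fun x hx => hx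
    | succ k ih => exact fun x hx => by rw [pow_succ]; exact ih _ (hN x hx)
  refine ⟨fun h x hx l => (A.emul_eq_zero_iff x l).1 (h hx l 0), fun h x hx l k => ?_⟩
  exact (A.emul_eq_zero_iff _ l).2 (h _ (hpow k x hx) l)

end Comparison

/-! ### Passage from `L` to `L/N`. -/

section Quotient

variable {F L : Type*} [Field F] [AddCommGroup L] [Module F L] (A : HomLieAlgebra F L)
  (N : Submodule F L) (hN : A.IsIdeal N)

/-- The map `(L ∧ L) / im d₃ → (L/N ∧ L/N) / im d₃` induced by the projection `L → L/N`. -/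
def boundaryQuotientMap : A.BoundaryQuotient →ₗ[F] (A.quotient N hN).BoundaryQuotient :=
  (LinearMap.range A.d₃).liftQ
    ((LinearMap.range (A.quotient N hN).d₃).mkQ ∘ₗ wedgeMap N.mkQ)
    (A.range_d₃_le_ker _ fun x y z => by
      simp only [LinearMap.comp_apply, wedgeMap_wedge]
      exact (A.quotient N hN).wedgeClass_boundary (N.mkQ x) (N.mkQ y) (N.mkQ z))

theorem boundaryQuotientMap_wedgeClass (x y : L) :
    A.boundaryQuotientMap N hN (A.wedgeClass x y) =
      (A.quotient N hN).wedgeClass (N.mkQ x) (N.mkQ y) := by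
  change (LinearMap.range (A.quotient N hN).d₃).mkQ (wedgeMap N.mkQ (wedge x y)) = _
  rw [wedgeMap_wedge]; rfl

theorem boundaryQuotientMap_surjective : Function.Surjective (A.boundaryQuotientMap N hN) := by
  intro t
  obtain ⟨u, rfl⟩ := Submodule.mkQ_surjective _ t
  obtain ⟨v, rfl⟩ := wedgeMap_surjective N.mkQ_surjective u
  exact ⟨Submodule.Quotient.mk v, rfl⟩

/-- If `N ∧ L ⊆ im d₃`, then `x ∧ y` modulo `im d₃` only depends on `x` and `y` modulo `N`. -/
def quotientWedgeClass (h : ∀ x ∈ N, ∀ l, A.wedgeClass x l = 0) :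
    (L ⧸ N) →ₗ[F] (L ⧸ N) →ₗ[F] A.BoundaryQuotient :=
  N.liftQ
    { toFun := fun x => N.liftQ (A.wedgeClass x) fun y hy => by
        rw [LinearMap.mem_ker, wedgeClass_skew, h y hy, neg_zero]
      map_add' := fun x x' => Submodule.linearMap_qext _ (LinearMap.ext fun y => by simp)
      map_smul' := fun c x => Submodule.linearMap_qext _ (LinearMap.ext fun y => by simp) }
    fun x hx => LinearMap.mem_ker.2
      (Submodule.linearMap_qext _ (LinearMap.ext fun y => by simpa using h x hx y))

theorem quotientWedgeClass_mk (h : ∀ x ∈ N, ∀ l, A.wedgeClass x l = 0) (x y : L) :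
    A.quotientWedgeClass N h (N.mkQ x) (N.mkQ y) = A.wedgeClass x y := rfl

/-- For `x ∈ N` the class of `x ∧ l` maps to `0 ∧ l = 0`, so injectivity forces it to vanish.
Conversely, if these classes vanish, the wedge descends to `L/N` and yields a left inverse. -/
theorem boundaryQuotientMap_injective_iff :
    Function.Injective (A.boundaryQuotientMap N hN) ↔ ∀ x ∈ N, ∀ l, A.wedgeClass x l = 0 := by
  refine ⟨fun hinj x hx l => hinj ?_, fun h => ?_⟩
  · have hx0 : N.mkQ x = 0 := by simpa using hx
    rw [boundaryQuotientMap_wedgeClass, hx0]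
    simp
  · have hself (x : L ⧸ N) : A.quotientWedgeClass N h x x = 0 := by
      obtain ⟨x, rfl⟩ := N.mkQ_surjective x
      rw [quotientWedgeClass_mk, wedgeClass_self]
    have hker : LinearMap.range (A.quotient N hN).d₃ ≤
        LinearMap.ker (wedgeLift (A.quotientWedgeClass N h) hself) := by
      -- Boundaries of `L/N` lift to boundaries of `L`, already zero in the target.
      refine (A.quotient N hN).range_d₃_le_ker _ fun x y z => ?_
      obtain ⟨x, rfl⟩ := N.mkQ_surjective x
      obtain ⟨y, rfl⟩ := N.mkQ_surjective y
      obtain ⟨z, rfl⟩ := N.mkQ_surjective z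
      simp only [wedgeLift_wedge]
      exact A.wedgeClass_boundary x y z
    have hinv : (LinearMap.range (A.quotient N hN).d₃).liftQ _ hker ∘ₗ
        A.boundaryQuotientMap N hN = LinearMap.id := by
      refine A.boundaryQuotient_ext fun x y => ?_
      rw [LinearMap.comp_apply, boundaryQuotientMap_wedgeClass]
      exact wedgeLift_wedge (A.quotientWedgeClass N h) hself (N.mkQ x) (N.mkQ y)
    exact Function.LeftInverse.injective (LinearMap.congr_fun hinv)

end Quotient

/-! ### Dimension counts. -/

section Dimension

variable {F L : Type*} [Field F] [AddCommGroup L] [Module F L]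

/-- Since `im g ⊆ ker f ⊆ V`, the space `V / im g` is an extension of `V / ker f ≅ im f` by `ker f /
im g`. -/
theorem finrank_kerModRange_add {U V W : Type*} [AddCommGroup U] [Module F U] [AddCommGroup V]
    [Module F V] [AddCommGroup W] [Module F W] [FiniteDimensional F V]
    (f : V →ₗ[F] W) (g : U →ₗ[F] V) (h : f ∘ₗ g = 0) :
    Module.finrank F (KerModRange f g) + Module.finrank F (LinearMap.range f) =
      Module.finrank F (V ⧸ LinearMap.range g) := by
  have h₁ := Submodule.finrank_quotient_add_finrank
    ((LinearMap.range g).submoduleOf (LinearMap.ker f))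
  rw [(Submodule.submoduleOfEquivOfLe (LinearMap.range_le_ker_iff.2 h)).finrank_eq] at h₁
  change Module.finrank F (KerModRange f g) + _ = _ at h₁
  have h₂ := Submodule.finrank_quotient_add_finrank (LinearMap.range g)
  have h₃ := f.finrank_range_add_finrank_ker
  omega

variable (A : HomLieAlgebra F L)

theorem range_d₂ : LinearMap.range A.d₂ = A.commutator := by
  apply le_antisymm
  · rw [← Submodule.ker_mkQ A.commutator, LinearMap.range_le_ker_iff]
    refine linearMap_ext_wedge fun x y => ?_
    rw [LinearMap.comp_apply, d₂_wedge, LinearMap.zero_apply, Submodule.mkQ_apply,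
      Submodule.Quotient.mk_eq_zero]
    exact A.commutator.neg_mem (Submodule.subset_span ⟨x, y, rfl⟩)
  · refine Submodule.span_le.2 ?_
    rintro _ ⟨x, y, rfl⟩
    exact ⟨-wedge x y, by rw [map_neg, d₂_wedge, neg_neg]⟩

theorem commutator_quotient (N : Submodule F L) (hN : A.IsIdeal N) :
    (A.quotient N hN).commutator = A.commutator.map N.mkQ := by
  rw [commutator, commutator, Submodule.map_span]
  congr 1
  ext t
  constructor
  · rintro ⟨x, y, rfl⟩
    obtain ⟨x, rfl⟩ := N.mkQ_surjective x
    obtain ⟨y, rfl⟩ := N.mkQ_surjective y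
    exact ⟨_, ⟨x, y, rfl⟩, rfl⟩
  · rintro ⟨_, ⟨x, y, rfl⟩, rfl⟩
    exact ⟨N.mkQ x, N.mkQ y, rfl⟩

variable [FiniteDimensional F L]

theorem finrank_H₂_add_finrank_commutator :
    Module.finrank F A.H₂ + Module.finrank F A.commutator =
      Module.finrank F A.BoundaryQuotient := by
  rw [← range_d₂]
  exact finrank_kerModRange_add A.d₂ A.d₃ A.d₂_comp_d₃

/-- Rank-nullity for the projection restricted to `S`, whose kernel is `N ∩ S`. -/
theorem finrank_map_mkQ_add_finrank_inf (N S : Submodule F L) :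
    Module.finrank F (S.map N.mkQ) + Module.finrank F (N ⊓ S : Submodule F L) =
      Module.finrank F S := by
  have h := (N.mkQ.domRestrict S).finrank_range_add_finrank_ker
  rw [LinearMap.range_domRestrict] at h
  have hker : LinearMap.ker (N.mkQ.domRestrict S) = (N ⊓ S).submoduleOf S := by
    ext x
    simp [Submodule.submoduleOf]
  rwa [hker, (Submodule.submoduleOfEquivOfLe inf_le_right).finrank_eq] at h

end Dimension

end

end HomLieAlgebra

theorem corollary5p3 {F L : Type*} [Field F] [AddCommGroup L] [Module F L] [FiniteDimensional F L]
    (A : HomLieAlgebra F L) (N : Submodule F L) (hN : A.IsCentralSubalgebra N) :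
    N ≤ A.exteriorCenter ↔
      Module.finrank F (A.quotient N hN.isIdeal).H₂ =
        Module.finrank F A.H₂ + Module.finrank F (N ⊓ A.commutator : Submodule F L) := by
  rw [A.le_exteriorCenter_iff hN.α_mem, ← A.boundaryQuotientMap_injective_iff N hN.isIdeal]
  have h₁ := A.finrank_H₂_add_finrank_commutator
  have h₂ := (A.quotient N hN.isIdeal).finrank_H₂_add_finrank_commutator
  rw [A.commutator_quotient] at h₂
  have h₃ := HomLieAlgebra.finrank_map_mkQ_add_finrank_inf N A.commutator
  have hsurj := A.boundaryQuotientMap_surjective N hN.isIdeal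
  -- A surjection between finite-dimensional spaces is injective exactly when the dimensions agree.
  have key : Function.Injective (A.boundaryQuotientMap N hN.isIdeal) ↔
      Module.finrank F A.BoundaryQuotient =
        Module.finrank F (A.quotient N hN.isIdeal).BoundaryQuotient :=
    ⟨fun h => (LinearEquiv.ofBijective _ ⟨h, hsurj⟩).finrank_eq,
      fun h => (LinearMap.injective_iff_surjective_of_finrank_eq_finrank h).2 hsurj⟩
  rw [key]
  -- Eliminating `dim [L, L]` and the dimension of its image in `L/N` from `h₁`, `h₂`, `h₃` leaves
  -- the equivalence of the two equalities.
  omega
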